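/- Let $E$ be a real Banach lattice that is atomic with a basis, in the sense that $E$ has a (finite or infinite) Schauder basis $(e_n)$ consisting of pairwise disjoint vectors, i.e. $|e_n|\wedge|e_m|=0$ for $n\neq m$ (equivalently, up to changing signs of the $e_n$, the order of $E$ is the coordinatewise order induced by the basis, which is then automatically unconditional). Suppose that $E$ is disjointly homogeneous (DH): for every two sequences $(x_n)$, $(y_n)$ of pairwise disjoint vectors of norm one in $E$ there are a constant $C>0$ and a strictly increasing sequence of indices $(n_k)$ such that for every $m$ and all real scalars $a_1,\dots,a_m$ $$C^{-1}\Bigl\|\sum_{k=1}^m a_k y_{n_k}\Bigr\|\le\Bigl\|\sum_{k=1}^m a_k x_{n_k}\Bigr\|\le C\Bigl\|\sum_{k=1}^m a_k y_{n_k}\Bigr\|.$$ Then every bounded linear operator $T:E\to E$ that is strictly singular (there are no infinite-dimensional subspace $V\subseteq E$ and $c>0$ with $\|Tv\|\ge c\|v\|$ for all $v\in V$) is compact. -/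

import Mathlib

namespace DHLattice

/-- Two elements of a vector lattice are disjoint when `|x| ∧ |y| = 0`. -/
def IsDisjoint {E : Type*} [AddCommGroup E] [Lattice E] (x y : E) : Prop :=
  |x| ⊓ |y| = 0

/-- A normalized disjoint sequence: unit vectors that are pairwise disjoint. -/
def IsNormalizedDisjoint {E : Type*} [NormedAddCommGroup E] [Lattice E] (x : ℕ → E) : Prop :=
  (∀ n, ‖x n‖ = 1) ∧ Pairwise (fun m n => IsDisjoint (x m) (x n))

/-- `C`-equivalence of sequences: the norms of linear combinations with the same coefficients
agree up to the factor `C`. Finite linear combinations suffice: the inequalities pass to the limit,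
and, applied to tails, they show that `∑ aₙ xₙ` converges exactly when `∑ aₙ yₙ` does. -/
def EquivWith {E : Type*} [NormedAddCommGroup E] [NormedSpace ℝ E]
    (C : ℝ) (x y : ℕ → E) : Prop :=
  ∀ (a : ℕ → ℝ) (n : ℕ),
    C⁻¹ * ‖∑ i ∈ Finset.range n, a i • y i‖ ≤ ‖∑ i ∈ Finset.range n, a i • x i‖ ∧
    ‖∑ i ∈ Finset.range n, a i • x i‖ ≤ C * ‖∑ i ∈ Finset.range n, a i • y i‖

/-- Disjointly homogeneous: for any two normalized disjoint sequences there are a constant and a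
common choice of indices along which they are equivalent. -/
def IsDisjointlyHomogeneous (E : Type*) [NormedAddCommGroup E] [NormedSpace ℝ E] [Lattice E] :
    Prop :=
  ∀ x y : ℕ → E, IsNormalizedDisjoint x → IsNormalizedDisjoint y →
    ∃ C : ℝ, 0 < C ∧ ∃ φ : ℕ → ℕ, StrictMono φ ∧
      EquivWith C (fun k => x (φ k)) (fun k => y (φ k))

/-- `E` is atomic with a basis: it has a Schauder basis (infinite, or finite when `E` is finite
dimensional) of pairwise disjoint vectors. Each basis vector is then, up to its sign, an atom, the
basis is unconditional, and after a change of signs `E` carries the coordinatewise order. -/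
def IsAtomicWithBasis (E : Type*) [NormedAddCommGroup E] [NormedSpace ℝ E] [Lattice E] : Prop :=
  (∃ b : SchauderBasis ℝ E, Pairwise (fun i j => IsDisjoint (b.basis i) (b.basis j))) ∨
  (∃ (n : ℕ) (b : Module.Basis (Fin n) ℝ E), Pairwise (fun i j => IsDisjoint (b i) (b j)))

/-- Strictly singular: on no infinite dimensional subspace is `T` invertible, that is, an
isomorphism onto its image, that is, bounded below. -/
def IsStrictlySingular {X Y : Type*} [NormedAddCommGroup X] [NormedSpace ℝ X]
    [NormedAddCommGroup Y] [NormedSpace ℝ Y] (T : X →L[ℝ] Y) : Prop :=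
  ∀ V : Submodule ℝ X, ¬ FiniteDimensional ℝ V →
    ¬ ∃ c : ℝ, 0 < c ∧ ∀ v ∈ V, c * ‖v‖ ≤ ‖T v‖

end DHLattice

open Filter Topology

namespace DHLattice

section Disjoint

variable {E : Type*} [AddCommGroup E] [Lattice E] [IsOrderedAddMonoid E]

theorem inf_add_le_of_nonneg {a b c : E} (ha : 0 ≤ a) (hb : 0 ≤ b) (hc : 0 ≤ c) :
    (a + b) ⊓ c ≤ a ⊓ c + b ⊓ c := by
  rw [add_inf, inf_add, inf_add]
  refine le_inf (le_inf inf_le_left ?_) (le_inf ?_ ?_) <;> refine inf_le_right.trans ?_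
  · exact le_add_of_nonneg_right hb
  · exact le_add_of_nonneg_left ha
  · exact le_add_of_nonneg_left hc

omit [IsOrderedAddMonoid E] in
theorem IsDisjoint.symm {x y : E} (h : IsDisjoint x y) : IsDisjoint y x := by
  rw [IsDisjoint, inf_comm]; exact h

theorem IsDisjoint.zero_left (y : E) : IsDisjoint 0 y := by
  simp [IsDisjoint]

theorem IsDisjoint.mono_left {x x' y : E} (h : IsDisjoint x y) (hx : |x'| ≤ |x|) :
    IsDisjoint x' y :=
  le_antisymm ((inf_le_inf_right _ hx).trans h.le) (le_inf (abs_nonneg _) (abs_nonneg _))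

theorem IsDisjoint.add_left {x y z : E} (hx : IsDisjoint x z) (hy : IsDisjoint y z) :
    IsDisjoint (x + y) z := by
  refine le_antisymm ?_ (le_inf (abs_nonneg _) (abs_nonneg _))
  refine (inf_le_inf_right _ (abs_add_le x y)).trans ?_
  refine (inf_add_le_of_nonneg (abs_nonneg _) (abs_nonneg _) (abs_nonneg _)).trans ?_
  rw [show |x| ⊓ |z| = 0 from hx, show |y| ⊓ |z| = 0 from hy, add_zero]

theorem IsDisjoint.nsmul_left {x y : E} (h : IsDisjoint x y) (n : ℕ) : IsDisjoint (n • x) y := by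
  induction n with
  | zero => simpa using IsDisjoint.zero_left y
  | succ n ih => rw [succ_nsmul]; exact ih.add_left h

theorem IsDisjoint.sum_left {ι : Type*} {s : Finset ι} {x : ι → E} {y : E}
    (h : ∀ i ∈ s, IsDisjoint (x i) y) : IsDisjoint (∑ i ∈ s, x i) y :=
  Finset.sum_induction x (IsDisjoint · y) (fun _ _ => IsDisjoint.add_left)
    (IsDisjoint.zero_left y) h

theorem IsDisjoint.abs_le_abs_add {x y : E} (h : IsDisjoint x y) : |x| ≤ |x + y| := by
  have h1 : |x| ≤ |x + y| + |y| := by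
    simpa using abs_add_le (x + y) (-y)
  calc |x| ≤ (|x + y| + |y|) ⊓ |x| := le_inf h1 le_rfl
    _ ≤ |x + y| ⊓ |x| + |y| ⊓ |x| :=
      inf_add_le_of_nonneg (abs_nonneg _) (abs_nonneg _) (abs_nonneg _)
    _ = |x + y| ⊓ |x| := by rw [show |y| ⊓ |x| = 0 from h.symm, add_zero]
    _ ≤ |x + y| := inf_le_left

theorem IsDisjoint.abs_add {x y : E} (h : IsDisjoint x y) : |x + y| = |x| + |y| := by
  refine le_antisymm (abs_add_le x y) ?_
  rw [← inf_add_sup, show |x| ⊓ |y| = 0 from h, zero_add]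
  refine sup_le h.abs_le_abs_add ?_
  rw [add_comm]
  exact h.symm.abs_le_abs_add

theorem abs_sum_of_pairwise_isDisjoint {ι : Type*} {x : ι → E}
    (h : Pairwise fun i j => IsDisjoint (x i) (x j)) (s : Finset ι) :
    |∑ i ∈ s, x i| = ∑ i ∈ s, |x i| := by
  classical
  induction s using Finset.induction_on with
  | empty => simp
  | insert i s hi ih =>
    rw [Finset.sum_insert hi, Finset.sum_insert hi, IsDisjoint.abs_add, ih]
    exact (IsDisjoint.sum_left fun j hj => h (ne_of_mem_of_not_mem hj hi)).symm

variable [Module ℝ E] [IsOrderedModule ℝ E]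

omit [IsOrderedAddMonoid E] in
theorem abs_real_smul_le (a : ℝ) (x : E) : |a • x| ≤ |a| • |x| := by
  have key : ∀ b : ℝ, ∀ y : E, b • y ≤ |b| • |y| := by
    intro b y
    rcases le_total 0 b with hb | hb
    · rw [abs_of_nonneg hb]
      exact smul_le_smul_of_nonneg_left (le_abs_self y) hb
    · rw [abs_of_nonpos hb, ← neg_smul_neg]
      exact smul_le_smul_of_nonneg_left (neg_le_abs y) (neg_nonneg.2 hb)
  refine abs_le'.2 ⟨key a x, ?_⟩
  simpa using key (-a) x

theorem abs_real_smul (a : ℝ) (x : E) : |a • x| = |a| • |x| := by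
  refine le_antisymm (abs_real_smul_le a x) ?_
  rcases eq_or_ne a 0 with rfl | ha
  · simp
  · have h := smul_le_smul_of_nonneg_left (abs_real_smul_le a⁻¹ (a • x)) (abs_nonneg a)
    rwa [inv_smul_smul₀ ha, smul_smul, ← abs_mul, mul_inv_cancel₀ ha, abs_one, one_smul] at h

theorem abs_real_smul_le_abs_real_smul {a b : ℝ} (h : |a| ≤ |b|) (x : E) :
    |a • x| ≤ |b • x| := by
  rw [abs_real_smul, abs_real_smul]
  exact smul_le_smul_of_nonneg_right h (abs_nonneg x)

theorem IsDisjoint.smul_left {x y : E} (h : IsDisjoint x y) (a : ℝ) : IsDisjoint (a • x) y := by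
  obtain ⟨n, hn⟩ := exists_nat_ge |a|
  refine (h.nsmul_left n).mono_left ?_
  rw [← Nat.cast_smul_eq_nsmul ℝ]
  exact abs_real_smul_le_abs_real_smul (by rwa [Nat.abs_cast]) x

theorem IsDisjoint.of_mem_span_left {s : Set E} {x y : E} (hs : ∀ z ∈ s, IsDisjoint z y)
    (hx : x ∈ Submodule.span ℝ s) : IsDisjoint x y := by
  induction hx using Submodule.span_induction with
  | mem z hz => exact hs z hz
  | zero => exact IsDisjoint.zero_left y
  | add z w _ _ hz hw => exact hz.add_left hw
  | smul a z _ hz => exact hz.smul_left a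

theorem IsDisjoint.of_mem_span {s t : Set E} {x y : E}
    (hst : ∀ z ∈ s, ∀ w ∈ t, IsDisjoint z w)
    (hx : x ∈ Submodule.span ℝ s) (hy : y ∈ Submodule.span ℝ t) : IsDisjoint x y :=
  IsDisjoint.of_mem_span_left
    (fun z hz => (IsDisjoint.of_mem_span_left (fun w hw => (hst z hz w hw).symm) hy).symm) hx

theorem IsDisjoint.smul_smul {x y : E} (h : IsDisjoint x y) (a b : ℝ) :
    IsDisjoint (a • x) (b • y) :=
  ((h.smul_left a).symm.smul_left b).symm

end Disjoint

section Norm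

variable {E : Type*} [NormedAddCommGroup E] [NormedSpace ℝ E] [Lattice E]
  [IsOrderedAddMonoid E] [IsOrderedModule ℝ E] [HasSolidNorm E]

theorem norm_sum_smul_le_of_abs_le {ι : Type*} {x : ι → E}
    (h : Pairwise fun i j => IsDisjoint (x i) (x j)) {a b : ι → ℝ} (s : Finset ι)
    (hab : ∀ i ∈ s, |a i| ≤ |b i|) :
    ‖∑ i ∈ s, a i • x i‖ ≤ ‖∑ i ∈ s, b i • x i‖ := by
  refine norm_le_norm_of_abs_le_abs ?_
  rw [abs_sum_of_pairwise_isDisjoint (fun i j hij => (h hij).smul_smul (a i) (a j)),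
    abs_sum_of_pairwise_isDisjoint (fun i j hij => (h hij).smul_smul (b i) (b j))]
  exact Finset.sum_le_sum fun i hi => abs_real_smul_le_abs_real_smul (hab i hi) (x i)

theorem IsNormalizedDisjoint.abs_coeff_le {x : ℕ → E} (hx : IsNormalizedDisjoint x)
    (a : ℕ → ℝ) {s : Finset ℕ} {i : ℕ} (hi : i ∈ s) : |a i| ≤ ‖∑ j ∈ s, a j • x j‖ := by
  have h := norm_sum_smul_le_of_abs_le hx.2 (a := Pi.single i (a i)) (b := a) s fun j _ => by
    rcases eq_or_ne j i with rfl | hj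
    · simp
    · simp [hj]
  rw [Finset.sum_eq_single_of_mem i hi (fun j _ hj => by simp [hj])] at h
  simpa [norm_smul, hx.1 i] using h

theorem IsNormalizedDisjoint.linearIndependent {x : ℕ → E} (hx : IsNormalizedDisjoint x) :
    LinearIndependent ℝ x := by
  rw [linearIndependent_iff']
  intro s a ha i hi
  have := hx.abs_coeff_le a hi
  rw [ha, norm_zero] at this
  exact abs_eq_zero.1 (le_antisymm this (abs_nonneg _))

omit [NormedSpace ℝ E] [IsOrderedAddMonoid E] [IsOrderedModule ℝ E] [HasSolidNorm E] in
theorem IsNormalizedDisjoint.comp {x : ℕ → E} (hx : IsNormalizedDisjoint x) {φ : ℕ → ℕ}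
    (hφ : Function.Injective φ) : IsNormalizedDisjoint (x ∘ φ) :=
  ⟨fun _ => hx.1 _, fun _ _ hmn => hx.2 (hφ.ne hmn)⟩

end Norm

theorem exists_sum_range_of_mem_span_range {E : Type*} [AddCommGroup E] [Module ℝ E]
    {x : ℕ → E} {v : E} (hv : v ∈ Submodule.span ℝ (Set.range x)) :
    ∃ (a : ℕ → ℝ) (n : ℕ), v = ∑ i ∈ Finset.range n, a i • x i := by
  obtain ⟨c, rfl⟩ := Finsupp.mem_span_range_iff_exists_finsupp.1 hv
  obtain ⟨n, hn⟩ := c.support.exists_nat_subset_range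
  refine ⟨c, n, ?_⟩
  rw [Finsupp.sum]
  refine Finset.sum_subset hn fun i _ hi => ?_
  rw [Finsupp.notMem_support_iff.1 hi, zero_smul]

/-- An operator mapping one normalized disjoint sequence to summably small relative perturbations
of multiples, bounded away from zero, of a sequence dominating it is not strictly singular. -/
theorem not_isStrictlySingular_of_perturbation {E : Type*} [NormedAddCommGroup E]
    [NormedSpace ℝ E] [Lattice E] [IsOrderedAddMonoid E] [IsOrderedModule ℝ E] [HasSolidNorm E]
    (T : E →L[ℝ] E) {x y : ℕ → E} (hx : IsNormalizedDisjoint x) (hy : IsNormalizedDisjoint y)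
    {C : ℝ} (hC : 0 < C) (hxy : EquivWith C x y) {ρ : ℝ} (hρ : 0 < ρ) {r : ℕ → ℝ}
    (hr : ∀ k, ρ ≤ r k) (hT : ∀ k, ‖T (x k) - r k • y k‖ ≤ r k * ((1 / 2) ^ k / 4)) :
    ¬ IsStrictlySingular T := by
  intro hTs
  refine hTs (Submodule.span ℝ (Set.range x)) ?_ ⟨ρ / (2 * C), by positivity, ?_⟩
  · intro hfin
    exact Module.Finite.not_linearIndependent_of_infinite _
      (linearIndependent_span hx.linearIndependent)
  · intro v hv
    obtain ⟨a, n, rfl⟩ := exists_sum_range_of_mem_span_range hv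
    set s := Finset.range n
    set W := ‖∑ i ∈ s, (a i * r i) • y i‖
    have hr0 : ∀ k, 0 < r k := fun k => hρ.trans_le (hr k)
    have hgeom : ∑ i ∈ s, ((1 / 2 : ℝ) ^ i / 4) ≤ 1 / 2 := by
      rw [← Finset.sum_div]
      have := sum_geometric_two_le n
      linarith
    have herr : ‖T (∑ i ∈ s, a i • x i) - ∑ i ∈ s, (a i * r i) • y i‖ ≤ W / 2 := by
      have hEq : T (∑ i ∈ s, a i • x i) - ∑ i ∈ s, (a i * r i) • y i =
          ∑ i ∈ s, a i • (T (x i) - r i • y i) := by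
        simp only [map_sum, map_smul, smul_sub, smul_smul, Finset.sum_sub_distrib]
      rw [hEq]
      calc ‖∑ i ∈ s, a i • (T (x i) - r i • y i)‖
          ≤ ∑ i ∈ s, W * ((1 / 2 : ℝ) ^ i / 4) := by
            refine norm_sum_le_of_le _ fun i hi => ?_
            have h1 := hy.abs_coeff_le (fun i => a i * r i) hi
            rw [abs_mul, abs_of_pos (hr0 i)] at h1
            rw [norm_smul, Real.norm_eq_abs]
            calc |a i| * ‖T (x i) - r i • y i‖ ≤ |a i| * (r i * ((1 / 2) ^ i / 4)) := by
                  gcongr; exact hT i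
              _ = (|a i| * r i) * ((1 / 2) ^ i / 4) := by ring
              _ ≤ W * ((1 / 2) ^ i / 4) := by gcongr
        _ = W * ∑ i ∈ s, ((1 / 2 : ℝ) ^ i / 4) := by rw [Finset.mul_sum]
        _ ≤ W * (1 / 2) := by gcongr
        _ = W / 2 := by ring
    have hlow : W / 2 ≤ ‖T (∑ i ∈ s, a i • x i)‖ := by
      have := norm_sub_norm_le (∑ i ∈ s, (a i * r i) • y i) (T (∑ i ∈ s, a i • x i))
      rw [norm_sub_rev] at this
      linarith
    have hmono : ρ * ‖∑ i ∈ s, a i • y i‖ ≤ W := by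
      rw [← abs_of_pos hρ, ← Real.norm_eq_abs, ← norm_smul, Finset.smul_sum]
      simp only [smul_smul]
      refine norm_sum_smul_le_of_abs_le hy.2 s fun i _ => ?_
      rw [abs_mul, abs_mul, mul_comm, abs_of_pos hρ, abs_of_pos (hr0 i)]
      gcongr
      exact hr i
    calc ρ / (2 * C) * ‖∑ i ∈ s, a i • x i‖
        ≤ ρ / (2 * C) * (C * ‖∑ i ∈ s, a i • y i‖) := by gcongr; exact (hxy a n).2
      _ = ρ * ‖∑ i ∈ s, a i • y i‖ / 2 := by field_simp
      _ ≤ W / 2 := by gcongr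
      _ ≤ _ := hlow

/-- A non-compact operator is bounded below, by a uniform constant, at bounded vectors on which a
given compact operator is as small as desired. -/
theorem exists_lower_bound_of_not_isCompactOperator {E F G : Type*} [NormedAddCommGroup E]
    [NormedSpace ℝ E] [NormedAddCommGroup F] [NormedSpace ℝ F] [CompleteSpace F]
    [NormedAddCommGroup G] [NormedSpace ℝ G] {T : E →L[ℝ] F} (hT : ¬ IsCompactOperator T) :
    ∃ δ > 0, ∀ S : E →L[ℝ] G, IsCompactOperator S → ∀ η > 0,
      ∃ z, ‖z‖ ≤ 2 ∧ ‖S z‖ < η ∧ δ ≤ ‖T z‖ := by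
  by_contra! hcon
  refine hT ((isCompactOperator_iff_isCompact_closure_image_closedBall
    (T : E →ₗ[ℝ] F) one_pos).2 ?_)
  refine TotallyBounded.isCompact_of_isClosed (TotallyBounded.closure ?_) isClosed_closure
  rw [Metric.totallyBounded_iff]
  intro ε hε
  obtain ⟨S, hS, η, hη, h⟩ := hcon ε hε
  have hSb : TotallyBounded (S '' Metric.closedBall 0 1) :=
    (hS.isCompact_closure_image_closedBall 1).totallyBounded.subset subset_closure
  obtain ⟨t, htsub, htfin, ht⟩ := Metric.finite_approx_of_totallyBounded hSb η hη
  choose! g hgball hgS using fun y (hy : y ∈ t) => htsub hy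
  refine ⟨(fun y => T (g y)) '' t, htfin.image _, ?_⟩
  rintro _ ⟨x, hx, rfl⟩
  obtain ⟨y, hy, hxy⟩ := Set.mem_iUnion₂.1 (ht ⟨x, hx, rfl⟩)
  refine Set.mem_iUnion₂.2 ⟨_, ⟨y, hy, rfl⟩, ?_⟩
  rw [Metric.mem_ball, dist_eq_norm] at hxy ⊢
  refine (congrArg norm (map_sub T x (g y))).symm.trans_lt (h (x - g y) ?_ ?_)
  · have h1 := mem_closedBall_zero_iff.1 hx
    have h2 := mem_closedBall_zero_iff.1 (hgball y hy)
    linarith [norm_sub_le x (g y)]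
  · rwa [map_sub, hgS y hy]

theorem _root_.IsCompactOperator.prodMk {E F G : Type*} [Zero E] [TopologicalSpace E]
    [TopologicalSpace F] [TopologicalSpace G] {f : E → F} {g : E → G}
    (hf : IsCompactOperator f) (hg : IsCompactOperator g) :
    IsCompactOperator fun x => (f x, g x) := by
  obtain ⟨K, hK, hKf⟩ := hf
  obtain ⟨L, hL, hLg⟩ := hg
  exact ⟨K ×ˢ L, hK.prod hL, mem_of_superset (inter_mem hKf hLg) fun _ hx => hx⟩

theorem _root_.SchauderBasis.isCompactOperator_proj {E : Type*} [NormedAddCommGroup E]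
    [NormedSpace ℝ E] (b : SchauderBasis ℝ E) (n : ℕ) : IsCompactOperator (b.proj n) := by
  change b.proj n ∈ compactOperator (RingHom.id ℝ) E E
  refine (compactOperator (RingHom.id ℝ) E E).sum_mem fun i _ => ?_
  exact (isCompactOperator_of_locallyCompactSpace_dom (b.coord i)).continuous_comp
    (g := fun c : ℝ => c • b i) (by fun_prop)

/-- For a Schauder basis and a non-compact operator there are normalized vectors `x` and
`y` supported on a block of the basis arbitrarily far out, with `T x` close to a multiple of `y`. -/
theorem exists_block_of_not_isCompactOperator {E : Type*} [NormedAddCommGroup E]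
    [NormedSpace ℝ E] [CompleteSpace E] (b : SchauderBasis ℝ E) {T : E →L[ℝ] E}
    (hT : ¬ IsCompactOperator T) :
    ∃ ρ > 0, ∀ N : ℕ, ∀ ε > 0, ∃ M ≥ N, ∃ x ∈ Submodule.span ℝ (b '' Set.Ico N M),
      ∃ y ∈ Submodule.span ℝ (b '' Set.Ico N M), ‖x‖ = 1 ∧ ‖y‖ = 1 ∧
        ∃ r ≥ ρ, ‖T x - r • y‖ ≤ r * ε := by
  obtain ⟨δ, hδ, h⟩ := exists_lower_bound_of_not_isCompactOperator (G := E × E) hT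
  refine ⟨δ / 6, by positivity, fun N ε hε => ?_⟩
  have hS : IsCompactOperator
      (((b.proj N).comp (.id ℝ E)).prod ((b.proj N).comp T) : E →L[ℝ] E × E) :=
    ((b.isCompactOperator_proj N).comp_clm _).prodMk ((b.isCompactOperator_proj N).comp_clm T)
  obtain ⟨η, hη, hη1, hη2, hη3⟩ : ∃ η > 0, η ≤ 1 / 2 ∧ 2 * η ≤ δ / 2 ∧
      (‖T‖ + 1) * (2 * η) ≤ min (δ / 4) (δ / 2 * ε) := by
    set c := min (δ / 4) (δ / 2 * ε) with hc
    have hc0 : 0 < c := by positivity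
    have hT1 : 0 < 2 * (‖T‖ + 1) := by positivity
    refine ⟨min (1 / 2) (min (δ / 4) (c / (2 * (‖T‖ + 1)))), by positivity, min_le_left _ _, ?_, ?_⟩
    · have := (min_le_right (1 / 2) (min (δ / 4) (c / (2 * (‖T‖ + 1))))).trans (min_le_left _ _)
      linarith
    · have := (min_le_right (1 / 2) (min (δ / 4) (c / (2 * (‖T‖ + 1))))).trans (min_le_right _ _)
      rw [le_div_iff₀ hT1] at this
      linarith
  obtain ⟨z, hz2, hSz, hTz⟩ := h _ hS η hη
  have hblock : ∀ w : E, ∀ M ≥ N,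
      b.proj M w - b.proj N w ∈ Submodule.span ℝ (b '' Set.Ico N M) := by
    intro w M hM
    rw [b.proj_apply, b.proj_apply, ← Finset.sum_Ico_eq_sub _ hM]
    exact Submodule.sum_mem _ fun i hi => Submodule.smul_mem _ _
      (Submodule.subset_span ⟨i, by simpa using hi, rfl⟩)
  have happrox : ∀ w : E, ∀ᶠ M in atTop, ‖b.proj M w - w‖ < η := fun w => by
    simpa [dist_eq_norm] using (Metric.tendsto_nhds.1 (b.tendsto_proj w)) η hη
  obtain ⟨M, ⟨hM1, hM2⟩, hMN⟩ :=
    (((happrox z).and (happrox (T z))).and (eventually_ge_atTop N)).exists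
  have hNz : ‖b.proj N z‖ < η := (le_max_left _ _).trans_lt hSz
  have hNTz : ‖b.proj N (T z)‖ < η := (le_max_right _ _).trans_lt hSz
  set u := b.proj M z - b.proj N z with hu
  set v := b.proj M (T z) - b.proj N (T z) with hv
  have hclose : ∀ p q w : E, ‖p - w‖ < η → ‖q‖ < η → ‖p - q - w‖ ≤ 2 * η := by
    intro p q w h1 h2
    have := norm_sub_le (p - w) q
    rw [show p - w - q = p - q - w by abel] at this
    linarith
  have huz : ‖u - z‖ ≤ 2 * η := hclose _ _ _ hM1 hNz
  have hvz : ‖v - T z‖ ≤ 2 * η := hclose _ _ _ hM2 hNTz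
  have hTuv : ‖T u - v‖ ≤ (‖T‖ + 1) * (2 * η) := by
    have h1 : T u - v = T (u - z) - (v - T z) := by rw [map_sub T u z]; abel
    have h2 : ‖T (u - z)‖ ≤ ‖T‖ * (2 * η) := (T.le_opNorm _).trans (by gcongr)
    rw [h1]
    refine (norm_sub_le _ _).trans ?_
    linarith
  have hu3 : ‖u‖ ≤ 3 := by
    have := norm_le_norm_add_norm_sub' u z
    linarith
  have hvδ : δ / 2 ≤ ‖v‖ := by
    have := norm_le_norm_add_norm_sub v (T z)
    linarith
  have hv0 : 0 < ‖v‖ := by linarith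
  have hu0 : 0 < ‖u‖ := by
    rw [norm_pos_iff]
    intro h0
    rw [h0, map_zero, zero_sub, norm_neg] at hTuv
    have := hTuv.trans (hη3.trans (min_le_left _ _))
    linarith
  refine ⟨M, hMN, ‖u‖⁻¹ • u, Submodule.smul_mem _ _ (hblock _ M hMN), ‖v‖⁻¹ • v,
    Submodule.smul_mem _ _ (hblock _ M hMN), norm_smul_inv_norm (norm_pos_iff.1 hu0),
    norm_smul_inv_norm (norm_pos_iff.1 hv0), ‖v‖ / ‖u‖, ?_, ?_⟩
  · rw [ge_iff_le, le_div_iff₀ hu0]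
    nlinarith
  · have h1 : T (‖u‖⁻¹ • u) - (‖v‖ / ‖u‖) • ‖v‖⁻¹ • v = ‖u‖⁻¹ • (T u - v) := by
      rw [map_smul, smul_smul, smul_sub _ (T u), div_mul_eq_mul_div, mul_inv_cancel₀ hv0.ne',
        one_div]
    rw [h1, norm_smul, norm_inv, norm_norm]
    calc ‖u‖⁻¹ * ‖T u - v‖ ≤ ‖u‖⁻¹ * (‖v‖ * ε) := by
          gcongr
          refine (hTuv.trans (hη3.trans (min_le_right _ _))).trans ?_
          gcongr
      _ = ‖v‖ / ‖u‖ * ε := by ring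

/-- The gliding hump: a non-compact operator maps some normalized disjoint sequence close to
multiples of another one. -/
theorem exists_normalizedDisjoint_of_not_isCompactOperator {E : Type*} [NormedAddCommGroup E]
    [NormedSpace ℝ E] [CompleteSpace E] [Lattice E] [IsOrderedAddMonoid E] [IsOrderedModule ℝ E]
    (b : SchauderBasis ℝ E) (hb : Pairwise fun i j => IsDisjoint (b.basis i) (b.basis j))
    {T : E →L[ℝ] E} (hT : ¬ IsCompactOperator T) {ε : ℕ → ℝ} (hε : ∀ k, 0 < ε k) :
    ∃ x y : ℕ → E, IsNormalizedDisjoint x ∧ IsNormalizedDisjoint y ∧ ∃ ρ > 0, ∃ r : ℕ → ℝ,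
      ∀ k, ρ ≤ r k ∧ ‖T (x k) - r k • y k‖ ≤ r k * ε k := by
  obtain ⟨ρ, hρ, h⟩ := exists_block_of_not_isCompactOperator b hT
  choose M hM x hx y hy hx1 hy1 r hr hTr using fun N k => h N (ε k) (hε k)
  let N : ℕ → ℕ := fun k => Nat.rec 0 (fun k n => M n k) k
  have hN : Monotone N := monotone_nat_of_le_succ fun k => hM (N k) k
  have hdisj : ∀ w : ℕ → E, (∀ k, w k ∈ Submodule.span ℝ (b '' Set.Ico (N k) (N (k + 1)))) →
      Pairwise fun m n => IsDisjoint (w m) (w n) := by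
    intro w hw
    have : Std.Symm fun m n => IsDisjoint (w m) (w n) := ⟨fun _ _ => IsDisjoint.symm⟩
    refine pairwise_iff_lt.2 fun m n hmn => ?_
    refine IsDisjoint.of_mem_span ?_ (hw m) (hw n)
    rintro _ ⟨i, hi, rfl⟩ _ ⟨j, hj, rfl⟩
    exact hb (hi.2.trans_le ((hN hmn).trans hj.1)).ne
  exact ⟨fun k => x (N k) k, fun k => y (N k) k,
    ⟨fun k => hx1 _ _, hdisj _ fun k => hx (N k) k⟩,
    ⟨fun k => hy1 _ _, hdisj _ fun k => hy (N k) k⟩,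
    ρ, hρ, fun k => r (N k) k, fun k => ⟨hr _ _, hTr _ _⟩⟩

end DHLattice

theorem mainTheorem8 {E : Type*} [NormedAddCommGroup E] [NormedSpace ℝ E] [CompleteSpace E]
    [Lattice E] [IsOrderedAddMonoid E] [IsOrderedModule ℝ E] [HasSolidNorm E]
    (hbasis : DHLattice.IsAtomicWithBasis E)
    (hDH : DHLattice.IsDisjointlyHomogeneous E)
    (T : E →L[ℝ] E) (hT : DHLattice.IsStrictlySingular T) :
    IsCompactOperator T := by
  rcases hbasis with ⟨b, hb⟩ | ⟨n, b, -⟩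
  · by_contra hTc
    obtain ⟨x, y, hx, hy, ρ, hρ, r, hr⟩ :=
      DHLattice.exists_normalizedDisjoint_of_not_isCompactOperator b hb hTc
        (ε := fun k => (1 / 2) ^ k / 4) (fun k => by positivity)
    obtain ⟨C, hC, φ, hφ, hxy⟩ := hDH x y hx hy
    refine DHLattice.not_isStrictlySingular_of_perturbation T (hx.comp hφ.injective)
      (hy.comp hφ.injective) hC hxy hρ (r := r ∘ φ) (fun k => (hr _).1) (fun k => ?_) hT
    refine (hr (φ k)).2.trans ?_
    refine mul_le_mul_of_nonneg_left ?_ (hρ.le.trans (hr _).1)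
    exact div_le_div_of_nonneg_right
      (pow_le_pow_of_le_one (by norm_num) (by norm_num) (hφ.id_le k)) (by norm_num)
  · have : FiniteDimensional ℝ E := b.finiteDimensional_of_finite
    have : ProperSpace E := FiniteDimensional.proper ℝ E
    exact isCompactOperator_of_locallyCompactSpace_dom T
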